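/- Let $k$ be a commutative ring (for example $\mathbb Z$ or a field), let $n\ge 0$, and let $\mathbf w=(w_1,\dots,w_n)$ be a vector of non-negative integers with $|\mathbf w|=w_1+\dots+w_n$. For $d\ge 0$ let $R_d$ be the $k$-module of polynomials in $k[u_1,v_1,\dots,u_n,v_n]$ that are homogeneous of degree $d\,w_i$ in the pair $(u_i,v_i)$ for every $i$ and invariant under the group scheme $SL_2$ acting simultaneously and linearly on all the pairs $(u_i,v_i)$ (that is, invariant under $SL_2(A)$ after base change to every commutative $k$-algebra $A$). Thus $R_d=H^0((\mathbb P^1)^n,\mathcal O(d\mathbf w))^{SL_2}$, and $R_{\mathbf w}=\bigoplus_{d\ge 0}R_d$ is the graded ring of $SL_2$-invariants of $n$ ordered points on $\mathbb P^1$ with weights $\mathbf w$. Put $\varepsilon_{\mathbf w}=1$ if $|\mathbf w|$ is even and $\varepsilon_{\mathbf w}=2$ if $|\mathbf w|$ is odd. Kempe's Theorem. The $k$-algebra $R_{\mathbf w}$ is generated by $R_{\varepsilon_{\mathbf w}}$. Moreover, these are the invariants of lowest degree: if $R_d\neq 0$ for some $d>0$, then $\varepsilon_{\mathbf w}$ is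 the least $d>0$ with $R_d\neq 0$. -/

import Mathlib

universe u

namespace PointsOnLine

/-- The homogeneous coordinate ring of `(ℙ¹)ⁿ` over `k`: the polynomial ring in the variables
`u i = X (i, 0)` and `v i = X (i, 1)`, the homogeneous coordinates of the `i`-th point. -/
abbrev CoordRing (n : ℕ) (k : Type u) [CommRing k] : Type u :=
  MvPolynomial (Fin n × Fin 2) k

/-- Each of the two coordinates of the `i`-th point has multidegree the `i`-th unit vector. -/
def coordDegree (n : ℕ) : Fin n × Fin 2 → (Fin n → ℕ) := fun q => Pi.single q.1 1

/-- The simultaneous substitution `(u i, v i) ↦ M (u i, v i)` for all `i`, for a matrix `M` in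
`SL₂(A)` with entries in a `k`-algebra `A`, as a map `k[u, v] → A[u, v]`. -/
noncomputable def act {n : ℕ} {k : Type u} [CommRing k] {A : Type u} [CommRing A] [Algebra k A]
    (M : Matrix.SpecialLinearGroup (Fin 2) A) : CoordRing n k →ₐ[k] CoordRing n A :=
  MvPolynomial.aeval fun q =>
    ∑ j : Fin 2, MvPolynomial.C ((M : Matrix (Fin 2) (Fin 2) A) q.2 j) * MvPolynomial.X (q.1, j)

/-- Invariance under the group scheme `SL₂` over `k`: after every base change `k → A`, the
polynomial is fixed by the group `SL₂(A)`. (The algebras in the universe of `k` include the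
coordinate ring of `SL₂`, hence the generic matrix, so this is the usual coaction condition.) -/
def IsInvariant {n : ℕ} {k : Type u} [CommRing k] (f : CoordRing n k) : Prop :=
  ∀ (A : Type u) [CommRing A] [Algebra k A] (M : Matrix.SpecialLinearGroup (Fin 2) A),
    act M f = MvPolynomial.mapAlgHom (σ := Fin n × Fin 2) (Algebra.ofId k A) f

/-- The subalgebra of all `SL₂`-invariant polynomials. -/
noncomputable def invariants (n : ℕ) (k : Type u) [CommRing k] :
    Subalgebra k (CoordRing n k) where
  carrier := {f | IsInvariant f}
  mul_mem' ha hb A _ _ M := by rw [map_mul, map_mul, ha A M, hb A M]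
  add_mem' ha hb A _ _ M := by rw [map_add, map_add, ha A M, hb A M]
  algebraMap_mem' r A _ _ M := by rw [AlgHom.commutes, AlgHom.commutes]

/-- The degree `d` invariants for the weight `w`, that is, the invariant sections of `𝒪(d w)` on
`(ℙ¹)ⁿ`: the `SL₂`-invariant polynomials that are homogeneous of degree `d * w i` in the
coordinates of the `i`-th point, for every `i`. -/
noncomputable def piece {n : ℕ} (k : Type u) [CommRing k] (w : Fin n → ℕ) (d : ℕ) :
    Submodule k (CoordRing n k) :=
  MvPolynomial.weightedHomogeneousSubmodule k (coordDegree n) (d • w) ⊓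
    Subalgebra.toSubmodule (invariants n k)

instance piece_gradedMonoid {n : ℕ} (k : Type u) [CommRing k] (w : Fin n → ℕ) :
    SetLike.GradedMonoid (piece k w) where
  one_mem := by
    refine ⟨?_, (invariants n k).one_mem⟩
    rw [zero_smul]
    exact MvPolynomial.isWeightedHomogeneous_one k (coordDegree n)
  mul_mem i j f g hf hg := by
    refine ⟨?_, (invariants n k).mul_mem hf.2 hg.2⟩
    rw [add_smul]
    exact MvPolynomial.IsWeightedHomogeneous.mul hf.1 hg.1

open scoped DirectSum in
/-- The graded ring `⨁_d H⁰((ℙ¹)ⁿ, 𝒪(d w))^{SL₂}` of invariants of `n` points on the projective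
line with weights `w`. -/
abbrev InvariantRing {n : ℕ} (k : Type u) [CommRing k] (w : Fin n → ℕ) : Type u :=
  ⨁ d : ℕ, piece k w d

/-- `ε_w` is `1` if the total weight is even and `2` if it is odd. -/
def eps {n : ℕ} (w : Fin n → ℕ) : ℕ := if Even (∑ i, w i) then 1 else 2

end PointsOnLine

/-!
Invariants of points on the line are spanned by bracket monomials `∏ [a b]`, where
`[a b] = u_a v_b - u_b v_a`, and a bracket monomial is the same as a multigraph on the points whose
degree sequence is the multidegree. Kempe's theorem then becomes the statement that every multigraph
with degree sequence `d • w` decomposes, up to the Plücker relation, into `d` multigraphs with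
degree sequence `w`, when `|w|` is even.

Spanning holds over every commutative ring (`IsInvariant.mem_bracketSpan`). Let two points `a` and
`b` collide. By induction on the number of points the restricted invariant is a combination of
bracket monomials, and these lift, since the half-edges at the merged vertex may be redistributed
(`exists_graph_lift`). What is left vanishes for `x_b = x_a`, so it is divisible by `[a b]`
(`bracket_dvd_of_movePoints_eq_zero`), and the quotient is an invariant because `[a b]` is a
nonzerodivisor; induction on the degree finishes.

For the decomposition (`bracketSpan_nsmul_le_pow`), replace each point `i` by `w i` copies, so that
the multigraph becomes `d`-regular on `|w|` vertices, and divide the copies into two halves of equal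
size. By regularity there are as many edges inside one half as inside the other, and the Plücker
relation `[a b][c d] = [a c][b d] - [a d][b c]` removes them in pairs (`bracketSpan_le_crossSpan`).
A regular bipartite multigraph is a union of perfect matchings by Hall's theorem
(`exists_perfect_matching`), and each matching has degree sequence `w` after the copies are
identified again.

If `|w|` is odd, the handshake lemma leaves no invariants in odd degree, and the above applies to
`2 • w`. The least degree comes out of the same two facts: a nonzero piece lives in a degree
`m * ε`, and it is contained in the `m`-th power of the piece of degree `ε`, which
therefore is nonzero.
-/

namespace PointsOnLine

open MvPolynomial

/-! ### Brackets and divisibility by a bracket -/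

section Brackets

variable {V W : Type} {k : Type u} [CommRing k]

/-- The multidegree in the points, recorded as a multiset of points: both coordinates of `v` have
degree `{v}`. A multiset serves at once as a multidegree and as the degree sequence of a
multigraph. -/
def ptDegree (V : Type) : V × Fin 2 → Multiset V := fun q => {q.1}

/-- The bracket `[a b] = u_a v_b - u_b v_a`. -/
noncomputable def bracket (k : Type u) [CommRing k] (a b : V) : MvPolynomial (V × Fin 2) k :=
  X (a, 0) * X (b, 1) - X (b, 0) * X (a, 1)

/-- Substitution of the coordinates of `π a` for those of `a`. For non-injective `π` this lets
points collide. -/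
noncomputable def movePoints (k : Type u) [CommRing k] (π : W → V) :
    MvPolynomial (W × Fin 2) k →ₐ[k] MvPolynomial (V × Fin 2) k :=
  rename (Prod.map π id)

theorem weight_ptDegree (e : V × Fin 2 →₀ ℕ) :
    Finsupp.weight (ptDegree V) e = e.toMultiset.map Prod.fst := by
  induction e using Finsupp.induction_linear with
  | zero => simp
  | add f g hf hg => simp [hf, hg]
  | single q n => simp [Finsupp.weight_single, ptDegree, Multiset.map_nsmul]

theorem bracket_swap (a b : V) : bracket k a b = -bracket k b a := by
  unfold bracket; ring

theorem bracket_plucker (a b c d : V) :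
    bracket k a b * bracket k c d =
      bracket k a c * bracket k b d - bracket k a d * bracket k b c := by
  unfold bracket; ring

theorem movePoints_eq_aeval (π : W → V) (f : MvPolynomial (W × Fin 2) k) :
    movePoints k π f = aeval (fun q => X (Prod.map π id q)) f := by
  refine congrArg (fun φ : _ →ₐ[k] _ => φ f) (algHom_ext fun q => ?_)
  simp [movePoints]

theorem movePoints_bracket (π : W → V) (a b : W) :
    movePoints k π (bracket k a b) = bracket k (π a) (π b) := by
  simp [movePoints, bracket]

theorem isWeightedHomogeneous_bracket (a b : V) :
    IsWeightedHomogeneous (ptDegree V) (bracket k a b) ({a} + {b}) := by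
  unfold bracket
  refine ((isWeightedHomogeneous_X k _ (a, (0 : Fin 2))).mul
    (isWeightedHomogeneous_X k _ (b, (1 : Fin 2)))).sub ?_
  have := (isWeightedHomogeneous_X k (ptDegree V) (b, (0 : Fin 2))).mul
    (isWeightedHomogeneous_X k (ptDegree V) (a, (1 : Fin 2)))
  rwa [add_comm] at this

theorem isWeightedHomogeneous_movePoints (π : W → V) {f : MvPolynomial (W × Fin 2) k}
    {s : Multiset W} (hf : IsWeightedHomogeneous (ptDegree W) f s) :
    IsWeightedHomogeneous (ptDegree V) (movePoints k π f) (s.map π) := by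
  intro e he
  obtain ⟨e', rfl, he'⟩ := coeff_rename_ne_zero _ _ _ he
  rw [weight_ptDegree, ← Finsupp.toMultiset_map, ← hf he', weight_ptDegree, Multiset.map_map,
    Multiset.map_map]
  rfl

/-- Multihomogeneity as a scaling law: scaling the coordinates of each point `v` by `c v` multiplies
the value by the product of the `c v` over the multidegree. Only the points in the multidegree
matter. -/
theorem aeval_scale {A : Type*} [CommRing A] [Algebra k A] (c : V → A) (g g' : V × Fin 2 → A)
    {f : MvPolynomial (V × Fin 2) k} {s : Multiset V}
    (hf : IsWeightedHomogeneous (ptDegree V) f s)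
    (h : ∀ q : V × Fin 2, q.1 ∈ s → g' q = c q.1 * g q) :
    aeval g' f = (s.map c).prod * aeval g f := by
  induction hf using IsWeightedHomogeneous.induction_on with
  | zero => simp
  | add p q _ _ hp hq => rw [map_add, map_add, hp, hq, mul_add]
  | monomial e r he =>
    rw [weight_ptDegree] at he
    subst he
    rw [aeval_monomial, aeval_monomial, Multiset.map_map, mul_left_comm]
    congr 1
    have key : ∀ G : V × Fin 2 → A, (e.prod fun i n => G i ^ n) = (e.toMultiset.map G).prod := by
      intro G
      rw [Finsupp.toMultiset_map, Finsupp.prod_toMultiset, Finsupp.prod_mapDomain_index] <;>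
        simp [pow_add]
    rw [key, key, ← Multiset.prod_map_mul]
    exact congrArg _ (Multiset.map_congr rfl fun q hq => h q (Multiset.mem_map_of_mem _ hq))

theorem X_dvd_of_aeval_update_eq_zero {σ : Type*} [DecidableEq σ] (q : σ) {f : MvPolynomial σ k}
    (hf : aeval (Function.update X q 0 : σ → MvPolynomial σ k) f = 0) : X q ∣ f := by
  have h : (Ideal.Quotient.mkₐ k (Ideal.span {X q})).comp
      (aeval (Function.update X q 0 : σ → MvPolynomial σ k)) =
      Ideal.Quotient.mkₐ k (Ideal.span {(X q : MvPolynomial σ k)}) := by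
    refine algHom_ext fun i => ?_
    by_cases hi : i = q
    · subst hi
      simp
    · simp [hi]
  have h' := congrArg (fun φ => φ f) h
  simp only [AlgHom.comp_apply, hf, map_zero] at h'
  rw [← Ideal.mem_span_singleton, ← Ideal.Quotient.eq_zero_iff_mem]
  exact h'.symm

variable [DecidableEq V]

theorem aeval_update_bracket {a b : V} (hab : a ≠ b) :
    aeval (Function.update X (a, 0) 0 : _ → MvPolynomial (V × Fin 2) k) (bracket k a b) =
      -(X (b, 0) * X (a, 1)) := by
  simp [bracket, hab.symm]

/-- Setting `u_a = 0` turns `[a b]` into a monomial, so an annihilator `f` of `[a b]` is divisible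
by `u_a`, and the quotient is again an annihilator; descent on the degree in `u_a` gives `f = 0`.
The coefficient ring may have zero divisors. -/
theorem eq_zero_of_bracket_mul_eq_zero {a b : V} (hab : a ≠ b) (n : ℕ)
    (f : MvPolynomial (V × Fin 2) k) (hn : degreeOf (a, 0) f < n)
    (hf : bracket k a b * f = 0) : f = 0 := by
  induction n generalizing f with
  | zero => omega
  | succ n ih =>
    by_contra hf0
    have h : X (b, 0) * (X (a, 1) *
        aeval (Function.update X (a, 0) 0 : _ → MvPolynomial (V × Fin 2) k) f) = 0 := by
      have := congrArg (aeval (Function.update X (a, 0) 0 : _ → MvPolynomial (V × Fin 2) k)) hf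
      rwa [map_mul, map_zero, aeval_update_bracket hab, neg_mul, neg_eq_zero, mul_assoc] at this
    rw [isRegular_X.left.mul_left_eq_zero_iff, isRegular_X.left.mul_left_eq_zero_iff] at h
    obtain ⟨g, rfl⟩ := X_dvd_of_aeval_update_eq_zero _ h
    have hg0 : g ≠ 0 := by rintro rfl; simp at hf0
    rw [mul_left_comm, isRegular_X.left.mul_left_eq_zero_iff] at hf
    rw [mul_comm, (degreeOf_mul_X_eq_degreeOf_add_one_iff _ _).2 hg0] at hn
    exact hg0 (ih g (by omega) hf)

theorem isRegular_bracket {a b : V} (hab : a ≠ b) :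
    IsRegular (bracket k a b : MvPolynomial (V × Fin 2) k) := by
  rw [← isLeftRegular_iff_isRegular, isLeftRegular_iff_right_eq_zero_of_mul]
  exact fun f hf => eq_zero_of_bracket_mul_eq_zero hab _ f (Nat.lt_succ_self _) hf

/-- The coordinate `u_a` is a nonzerodivisor modulo `[a b]`. -/
theorem bracket_dvd_of_dvd_X_mul {a b : V} (hab : a ≠ b) {f : MvPolynomial (V × Fin 2) k}
    (h : bracket k a b ∣ X (a, 0) * f) : bracket k a b ∣ f := by
  obtain ⟨g, hg⟩ := h
  have h0 := congrArg (aeval (Function.update X (a, 0) 0 : _ → MvPolynomial (V × Fin 2) k)) hg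
  rw [map_mul, map_mul, aeval_update_bracket hab, aeval_X, Function.update_self, zero_mul,
    eq_comm, neg_mul, neg_eq_zero, mul_assoc, isRegular_X.left.mul_left_eq_zero_iff,
    isRegular_X.left.mul_left_eq_zero_iff] at h0
  obtain ⟨g', rfl⟩ := X_dvd_of_aeval_update_eq_zero _ h0
  refine ⟨g', isRegular_X.left (?_ : X (a, 0) * f = X (a, 0) * _)⟩
  rw [hg, mul_left_comm]

/-- A multihomogeneous polynomial that vanishes when `b` collides with `a` is divisible by `[a b]`.
Modulo `[a b]` the vectors `u_a • (u_b, v_b)` and `u_b • (u_a, v_a)` agree, so by the scaling law a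
power of `u_a` times `f` is congruent to a power of `u_b` times the restriction of `f` to
`x_b = x_a`, which is zero; the power of `u_a` then cancels. -/
theorem bracket_dvd_of_movePoints_eq_zero {a b : V} (hab : a ≠ b)
    {f : MvPolynomial (V × Fin 2) k} {s : Multiset V}
    (hf : IsWeightedHomogeneous (ptDegree V) f s)
    (h0 : movePoints k (Function.update id b a) f = 0) : bracket k a b ∣ f := by
  -- `c 0` and `c 1` scale the point `b` by `u_a` and by `u_b`, and fix the other points.
  set c : Fin 2 → V → MvPolynomial (V × Fin 2) k := fun ε =>
    Function.update 1 b (X (if ε = 0 then a else b, 0)) with hc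
  have h1 : aeval (fun q : V × Fin 2 => c 0 q.1 * X q) f = (s.map (c 0)).prod * f := by
    rw [aeval_scale (c 0) X _ hf fun _ _ => rfl, aeval_X_left_apply]
  have h2 : aeval (fun q : V × Fin 2 => c 1 q.1 * X (Prod.map (Function.update id b a) id q)) f
      = 0 := by
    rw [aeval_scale (c 1) (fun q => X (Prod.map (Function.update id b a) id q)) _ hf
      fun _ _ => rfl]
    exact mul_eq_zero_of_right _ ((movePoints_eq_aeval _ f).symm.trans h0)
  have h3 : (Ideal.Quotient.mkₐ k (Ideal.span {bracket k a b})).comp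
      (aeval (fun q : V × Fin 2 => c 0 q.1 * X q)) =
      (Ideal.Quotient.mkₐ k (Ideal.span {bracket k a b})).comp
      (aeval (fun q : V × Fin 2 => c 1 q.1 * X (Prod.map (Function.update id b a) id q))) := by
    refine algHom_ext fun q => ?_
    obtain ⟨v, ε⟩ := q
    simp only [AlgHom.comp_apply, aeval_X, Ideal.Quotient.mkₐ_eq_mk]
    rw [Ideal.Quotient.eq, Ideal.mem_span_singleton]
    by_cases hv : v = b
    · subst hv
      fin_cases ε
      · simp [hc, mul_comm]
      · simp [hc, bracket]
    · simp [hc, hv]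
  have h4 := congrArg (fun φ => φ f) h3
  simp only [AlgHom.comp_apply, h1, h2, map_zero, Ideal.Quotient.mkₐ_eq_mk] at h4
  rw [Ideal.Quotient.eq_zero_iff_mem, Ideal.mem_span_singleton] at h4
  clear hf h1 h2
  induction s using Multiset.induction with
  | empty => simpa using h4
  | cons x s ih =>
    rw [Multiset.map_cons, Multiset.prod_cons, mul_assoc] at h4
    apply ih
    by_cases hx : x = b
    · subst hx
      exact bracket_dvd_of_dvd_X_mul hab (by simpa [hc] using h4)
    · simpa [hc, hx] using h4

theorem exists_homogeneous_eq_bracket_mul {a b : V} {f : MvPolynomial (V × Fin 2) k}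
    {s : Multiset V} (hf : IsWeightedHomogeneous (ptDegree V) f ({a} + {b} + s))
    (h : bracket k a b ∣ f) :
    ∃ g, IsWeightedHomogeneous (ptDegree V) g s ∧ f = bracket k a b * g := by
  obtain ⟨g, rfl⟩ := h
  -- The multihomogeneous component of degree `s` of any cofactor serves as `g`.
  refine ⟨weightedHomogeneousComponent (ptDegree V) s g,
    weightedHomogeneousComponent_mem _ _ _, ?_⟩
  let : GradedAlgebra (weightedHomogeneousSubmodule k (ptDegree V)) := weightedGradedAlgebra k _
  have := DirectSum.coe_decompose_mul_of_left_mem_of_le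
    (𝒜 := weightedHomogeneousSubmodule k (ptDegree V)) (b := g)
    (isWeightedHomogeneous_bracket (k := k) a b) (Multiset.le_add_right ({a} + {b}) s)
  rw [DirectSum.decompose_of_mem_same _ hf, add_tsub_cancel_left] at this
  rw [this, ← weightedDecomposition.decompose'_apply]
  rfl

end Brackets

/-! ### Multigraphs and the span of bracket monomials -/

section Graphs

variable {V W : Type} {k : Type u} [CommRing k]

/-- The multiset of endpoints of the edges of a multigraph, that is, its degree sequence. A
multigraph on `V` is a multiset of ordered pairs; loops are allowed. -/
def endpoints (G : Multiset (V × V)) : Multiset V := G.map Prod.fst + G.map Prod.snd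

/-- The bracket monomial of a multigraph: the product of the brackets of its edges. -/
noncomputable def bracketProd (k : Type u) [CommRing k] (G : Multiset (V × V)) :
    MvPolynomial (V × Fin 2) k :=
  (G.map fun e => bracket k e.1 e.2).prod

/-- The span of the bracket monomials of multidegree `s`. -/
noncomputable def bracketSpan (k : Type u) [CommRing k] (s : Multiset V) :
    Submodule k (MvPolynomial (V × Fin 2) k) :=
  Submodule.span k {f | ∃ G, endpoints G = s ∧ bracketProd k G = f}

theorem bracketProd_mem_bracketSpan (G : Multiset (V × V)) :
    bracketProd k G ∈ bracketSpan k (endpoints G) :=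
  Submodule.subset_span ⟨G, rfl, rfl⟩

theorem endpoints_add (G H : Multiset (V × V)) :
    endpoints (G + H) = endpoints G + endpoints H := by
  simp only [endpoints, Multiset.map_add]
  abel

theorem endpoints_cons (a b : V) (G : Multiset (V × V)) :
    endpoints ((a, b) ::ₘ G) = a ::ₘ b ::ₘ endpoints G := by
  simp [endpoints, Multiset.cons_swap]

theorem card_endpoints (G : Multiset (V × V)) : (endpoints G).card = 2 * G.card := by
  simp [endpoints, two_mul]

theorem endpoints_map (π : W → V) (G : Multiset (W × W)) :
    endpoints (G.map (Prod.map π π)) = (endpoints G).map π := by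
  simp [endpoints, Multiset.map_map]

theorem bracketProd_cons (a b : V) (G : Multiset (V × V)) :
    bracketProd k ((a, b) ::ₘ G) = bracket k a b * bracketProd k G := by
  simp [bracketProd]

theorem movePoints_bracketProd (π : W → V) (G : Multiset (W × W)) :
    movePoints k π (bracketProd k G) = bracketProd k (G.map (Prod.map π π)) := by
  simp only [bracketProd, map_multiset_prod, Multiset.map_map]
  exact congrArg _ (Multiset.map_congr rfl fun e _ => movePoints_bracket π _ _)

theorem mul_mem_bracketSpan {s t : Multiset V} {f g : MvPolynomial (V × Fin 2) k}
    (hf : f ∈ bracketSpan k s) (hg : g ∈ bracketSpan k t) : f * g ∈ bracketSpan k (s + t) := by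
  have : bracketSpan k s * bracketSpan k t ≤ bracketSpan k (s + t) := by
    rw [bracketSpan, bracketSpan, Submodule.span_mul_span]
    refine Submodule.span_mono ?_
    rintro _ ⟨_, ⟨G, rfl, rfl⟩, _, ⟨H, rfl, rfl⟩, rfl⟩
    exact ⟨G + H, endpoints_add G H, by simp [bracketProd]⟩
  exact this (Submodule.mul_mem_mul hf hg)

theorem bracket_mem_bracketSpan (a b : V) : bracket k a b ∈ bracketSpan k ({a} + {b}) :=
  Submodule.subset_span ⟨{(a, b)}, by simp [endpoints], by simp [bracketProd]⟩

theorem bracketSpan_eq_bot_of_odd {s : Multiset V} (hs : Odd s.card) : bracketSpan k s = ⊥ := by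
  rw [bracketSpan, Submodule.span_eq_bot]
  rintro _ ⟨G, rfl, rfl⟩
  rw [card_endpoints] at hs
  exact absurd hs (by simp)

theorem isWeightedHomogeneous_bracketProd (G : Multiset (V × V)) :
    IsWeightedHomogeneous (ptDegree V) (bracketProd k G) (endpoints G) := by
  induction G using Multiset.induction with
  | empty => exact isWeightedHomogeneous_one k _
  | cons e G ih =>
    rw [bracketProd_cons, endpoints_cons]
    simpa using (isWeightedHomogeneous_bracket e.1 e.2).mul ih

theorem isWeightedHomogeneous_of_mem_bracketSpan {s : Multiset V}
    {f : MvPolynomial (V × Fin 2) k} (hf : f ∈ bracketSpan k s) :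
    IsWeightedHomogeneous (ptDegree V) f s := by
  have : bracketSpan k s ≤ weightedHomogeneousSubmodule k (ptDegree V) s := by
    refine Submodule.span_le.2 ?_
    rintro _ ⟨G, rfl, rfl⟩
    exact isWeightedHomogeneous_bracketProd G
  exact this hf

/-- A multigraph whose degree sequence is the image of `s` under `π` is the image of a multigraph
with degree sequence `s`: distribute the half-edges at each vertex over the fibre. -/
theorem exists_graph_lift (π : W → V) (G : Multiset (V × V)) (s : Multiset W)
    (h : s.map π = endpoints G) : ∃ H, endpoints H = s ∧ H.map (Prod.map π π) = G := by
  classical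
  induction G using Multiset.induction generalizing s with
  | empty => exact ⟨0, by simpa [endpoints, eq_comm] using h, rfl⟩
  | cons e G ih =>
    obtain ⟨a, b⟩ := e
    rw [endpoints_cons, ← Multiset.map_eq_cons] at h
    obtain ⟨x, hx, rfl, h⟩ := h
    rw [← Multiset.map_eq_cons] at h
    obtain ⟨y, hy, rfl, h⟩ := h
    obtain ⟨H, hH, rfl⟩ := ih _ h
    refine ⟨(x, y) ::ₘ H, ?_, by simp⟩
    rw [endpoints_cons, hH, Multiset.cons_erase hy, Multiset.cons_erase hx]

theorem map_movePoints_bracketSpan (π : W → V) (s : Multiset W) :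
    (bracketSpan k s).map (movePoints k π).toLinearMap = bracketSpan k (s.map π) := by
  rw [bracketSpan, bracketSpan, Submodule.map_span]
  congr 1
  ext f
  constructor
  · rintro ⟨_, ⟨G, rfl, rfl⟩, rfl⟩
    exact ⟨_, endpoints_map π G, (movePoints_bracketProd π G).symm⟩
  · rintro ⟨G, hG, rfl⟩
    obtain ⟨H, hH, rfl⟩ := exists_graph_lift π G s hG.symm
    exact ⟨_, ⟨H, hH, rfl⟩, movePoints_bracketProd π H⟩

end Graphs

/-! ### The first fundamental theorem -/

section Invariants

variable {n : ℕ} {k : Type u} [CommRing k]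

theorem act_X {A : Type u} [CommRing A] [Algebra k A] (M : Matrix.SpecialLinearGroup (Fin 2) A)
    (q : Fin n × Fin 2) :
    act M (X q : CoordRing n k) = C (M q.2 0) * X (q.1, 0) + C (M q.2 1) * X (q.1, 1) := by
  simp [act]

theorem act_bracket {A : Type u} [CommRing A] [Algebra k A]
    (M : Matrix.SpecialLinearGroup (Fin 2) A) (a b : Fin n) :
    act M (bracket k a b) = bracket A a b := by
  have h : M 0 0 * M 1 1 - M 0 1 * M 1 0 = 1 := by
    rw [← Matrix.det_fin_two, M.det_coe]
  have h' := congrArg (C : A → CoordRing n A) h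
  simp only [map_sub, map_mul, map_one] at h'
  simp only [bracket, map_sub, map_mul, act_X]
  linear_combination (X (a, 0) * X (b, 1) - X (b, 0) * X (a, 1)) * h'

theorem mapAlgHom_bracket {A : Type u} [CommRing A] [Algebra k A] (a b : Fin n) :
    mapAlgHom (σ := Fin n × Fin 2) (Algebra.ofId k A) (bracket k a b) = bracket A a b := by
  simp [bracket]

theorem bracket_mem_invariants (a b : Fin n) : bracket k a b ∈ invariants n k :=
  fun _ _ _ M => (act_bracket M a b).trans (mapAlgHom_bracket a b).symm

theorem bracketSpan_le_invariants (s : Multiset (Fin n)) :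
    bracketSpan k s ≤ Subalgebra.toSubmodule (invariants n k) := by
  refine Submodule.span_le.2 ?_
  rintro _ ⟨G, -, rfl⟩
  refine (invariants n k).multiset_prod_mem fun f hf => ?_
  obtain ⟨e, -, rfl⟩ := Multiset.mem_map.1 hf
  exact bracket_mem_invariants _ _

theorem IsInvariant.of_bracket_mul {a b : Fin n} (hab : a ≠ b) {f : CoordRing n k}
    (hf : IsInvariant (bracket k a b * f)) : IsInvariant f := by
  intro A _ _ M
  have h := hf A M
  rw [map_mul, map_mul, act_bracket, mapAlgHom_bracket] at h
  exact (isRegular_bracket hab).left h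

theorem IsInvariant.movePoints (π : Fin n → Fin n) {f : CoordRing n k} (hf : IsInvariant f) :
    IsInvariant (movePoints k π f) := by
  intro A _ _ M
  have h1 : (act M).comp (PointsOnLine.movePoints k π) =
      ((PointsOnLine.movePoints A π).restrictScalars k).comp (act M) := by
    refine algHom_ext fun q => ?_
    simp [act, PointsOnLine.movePoints]
  have h2 : (mapAlgHom (Algebra.ofId k A)).comp (PointsOnLine.movePoints k π) =
      ((PointsOnLine.movePoints A π).restrictScalars k).comp (mapAlgHom (Algebra.ofId k A)) := by
    refine algHom_ext fun q => ?_
    simp [PointsOnLine.movePoints]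
  have h1' := congrArg (fun φ => φ f) h1
  have h2' := congrArg (fun φ => φ f) h2
  simp only [AlgHom.comp_apply] at h1' h2'
  rw [h1', h2', hf A M]

/-- When all points collide at `a`, an invariant becomes constant: over the ring with `u_a` inverted
there is a matrix in `SL₂` carrying `(1, 0)` to `(u_a, v_a)`, so the value at `(u_a, v_a)` is the
value at `(1, 0)`. -/
theorem IsInvariant.exists_movePoints_const_eq_C {f : CoordRing n k} (hf : IsInvariant f)
    (a : Fin n) : ∃ c : k, PointsOnLine.movePoints k (fun _ => a) f = C c := by
  set A := Localization.Away (X (a, 0) : CoordRing n k)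
  set ι := algebraMap (CoordRing n k) A with hι
  set t : A := IsLocalization.Away.invSelf (X (a, 0) : CoordRing n k)
  have hut : ι (X (a, 0)) * t = 1 := IsLocalization.Away.mul_invSelf _
  have hinj : Function.Injective ι := by
    refine IsLocalization.injective A (M := Submonoid.powers (X (a, 0) : CoordRing n k)) ?_
    rw [Submonoid.powers_le]
    exact isRegular_X.mem_nonZeroDivisors
  let M : Matrix.SpecialLinearGroup (Fin 2) A :=
    ⟨!![ι (X (a, 0)), 0; ι (X (a, 1)), t], by simp [Matrix.det_fin_two, hut]⟩
  -- All points are placed at `(1, 0)`.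
  let e : Fin n × Fin 2 → k := fun q => if q.2 = 0 then 1 else 0
  refine ⟨aeval e f, hinj ?_⟩
  have h1 : ((aeval fun q => algebraMap k A (e q)).restrictScalars k).comp (act M) =
      (IsScalarTower.toAlgHom k (CoordRing n k) A).comp
        (PointsOnLine.movePoints k fun _ => a) := by
    refine algHom_ext fun q => ?_
    obtain ⟨v, j⟩ := q
    fin_cases j <;> simp [act, e, M, PointsOnLine.movePoints, hι]
  have h2 : ((aeval fun q => algebraMap k A (e q) : CoordRing n A →ₐ[A] A).restrictScalars k).comp
      (mapAlgHom (Algebra.ofId k A)) = (Algebra.ofId k A).comp (aeval e) := by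
    refine algHom_ext fun q => ?_
    simp [Algebra.ofId_apply]
  have h1' := congrArg (fun φ => φ f) h1
  have h2' := congrArg (fun φ => φ f) h2
  simp only [AlgHom.comp_apply] at h1' h2'
  rw [hf A M, h2'] at h1'
  exact h1'.symm.trans (IsScalarTower.algebraMap_apply k (CoordRing n k) A _)

/-- The case of at most one point, where the invariant is constant: it is then a multiple of the
empty bracket monomial, or zero if the multidegree is not zero. -/
theorem IsInvariant.mem_bracketSpan_of_all_eq {f : CoordRing n k} (hf : IsInvariant f)
    {s : Multiset (Fin n)} (hs : IsWeightedHomogeneous (ptDegree (Fin n)) f s)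
    (h : ∀ a ∈ s, ∀ b ∈ s, a = b) : f ∈ bracketSpan k s := by
  have hC : ∃ c : k, f = C c := by
    rcases s.empty_or_exists_mem with rfl | ⟨a, ha⟩
    · have := aeval_scale (A := CoordRing n k) 1 0 X hs (by simp)
      rw [aeval_X_left_apply, Multiset.map_zero, Multiset.prod_zero, one_mul] at this
      exact ⟨_, this.trans (aeval_zero _)⟩
    · obtain ⟨c, hc⟩ := hf.exists_movePoints_const_eq_C a
      refine ⟨c, ?_⟩
      rw [← hc, movePoints_eq_aeval]
      have := aeval_scale (A := CoordRing n k) 1 (fun q => X (Prod.map (fun _ => a) id q)) X hs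
        (fun q hq => by simp [Prod.map, h a ha _ hq])
      simpa using this
  obtain ⟨c, rfl⟩ := hC
  by_cases hc : (C c : CoordRing n k) = 0
  · rw [hc]; exact zero_mem _
  · obtain rfl := IsWeightedHomogeneous.inj_right hc hs (isWeightedHomogeneous_C _ c)
    have := (bracketSpan k (0 : Multiset (Fin n))).smul_mem c (bracketProd_mem_bracketSpan 0)
    simpa [bracketProd, smul_eq_C_mul] using this

/-- **First fundamental theorem** for `SL₂` over any commutative ring: a multihomogeneous invariant
is a combination of bracket monomials. Let two points `a ≠ b` of the multidegree collide. The result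
is an invariant of fewer points, hence a combination of bracket monomials, and it lifts to such a
combination `g` of the original multidegree. The difference `f - g` vanishes when `b` collides with
`a`, so it is `[a b]` times an invariant of smaller degree. -/
theorem IsInvariant.mem_bracketSpan {f : CoordRing n k} (hf : IsInvariant f)
    {s : Multiset (Fin n)} (hs : IsWeightedHomogeneous (ptDegree (Fin n)) f s) :
    f ∈ bracketSpan k s := by
  by_cases h : ∀ a ∈ s, ∀ b ∈ s, a = b
  · exact hf.mem_bracketSpan_of_all_eq hs h
  push Not at h
  obtain ⟨a, ha, b, hb, hab⟩ := h
  have hmerge : PointsOnLine.movePoints k (Function.update id b a) f ∈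
      bracketSpan k (s.map (Function.update id b a)) := by
    -- The point `b` no longer occurs after the collision.
    have hlt : (s.map (Function.update id b a)).toFinset.card < s.toFinset.card := by
      refine Finset.card_lt_card ?_
      rw [Finset.ssubset_iff]
      refine ⟨b, ?_, ?_⟩
      · simp only [Multiset.mem_toFinset, Multiset.mem_map, Function.update_apply]
        grind
      · intro x
        simp only [Finset.mem_insert, Multiset.mem_toFinset, Multiset.mem_map,
          Function.update_apply]
        grind
    exact (hf.movePoints _).mem_bracketSpan (isWeightedHomogeneous_movePoints _ hs)
  rw [← map_movePoints_bracketSpan] at hmerge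
  obtain ⟨g, hg, hgf⟩ := hmerge
  have hsub : IsWeightedHomogeneous (ptDegree (Fin n)) (f - g) s :=
    hs.sub (isWeightedHomogeneous_of_mem_bracketSpan hg)
  obtain ⟨t, ht⟩ : ∃ t, s = {a} + {b} + t := by
    obtain ⟨s', rfl⟩ := Multiset.exists_cons_of_mem ha
    obtain ⟨t, rfl⟩ := Multiset.exists_cons_of_mem ((Multiset.mem_cons.1 hb).resolve_left hab.symm)
    exact ⟨t, by simp⟩
  rw [ht] at hsub
  obtain ⟨q, hq, hfq⟩ := exists_homogeneous_eq_bracket_mul hsub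
    (bracket_dvd_of_movePoints_eq_zero hab hsub
      (by rw [map_sub, sub_eq_zero]; exact hgf.symm))
  have hq_inv : IsInvariant q := by
    refine IsInvariant.of_bracket_mul hab ?_
    rw [← hfq]
    exact (invariants n k).sub_mem hf (bracketSpan_le_invariants _ hg)
  have hlt : t.card < s.card := by simp [ht]
  have hq_mem := hq_inv.mem_bracketSpan hq
  rw [← sub_add_cancel f g]
  refine add_mem ?_ hg
  rw [hfq, ht]
  exact mul_mem_bracketSpan (bracket_mem_bracketSpan a b) hq_mem
termination_by (s.card, s.toFinset.card)
decreasing_by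
  · rw [Multiset.card_map]
    exact Prod.Lex.right _ hlt
  · exact Prod.Lex.left _ _ hlt

end Invariants

/-! ### Regular multigraphs split into perfect matchings -/

section Bipartite

variable {P Q V : Type} {k : Type u} [CommRing k]

/-- The span of the bracket monomials of bipartite multigraphs with degree sequence `s` on the one
side and `t` on the other. -/
noncomputable def crossSpan (k : Type u) [CommRing k] (s : Multiset P) (t : Multiset Q) :
    Submodule k (MvPolynomial ((P ⊕ Q) × Fin 2) k) :=
  Submodule.span k {f | ∃ G : Multiset (P × Q), G.map Prod.fst = s ∧ G.map Prod.snd = t ∧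
    bracketProd k (G.map (Prod.map Sum.inl Sum.inr)) = f}

theorem bracketProd_add (G H : Multiset (V × V)) :
    bracketProd k (G + H) = bracketProd k G * bracketProd k H := by
  simp [bracketProd]

theorem bracketProd_cross_mem_crossSpan (G : Multiset (P × Q)) :
    bracketProd k (G.map (Prod.map Sum.inl Sum.inr)) ∈
      crossSpan k (G.map Prod.fst) (G.map Prod.snd) :=
  Submodule.subset_span ⟨G, rfl, rfl, rfl⟩

theorem mul_mem_crossSpan {s s' : Multiset P} {t t' : Multiset Q}
    {f g : MvPolynomial ((P ⊕ Q) × Fin 2) k}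
    (hf : f ∈ crossSpan k s t) (hg : g ∈ crossSpan k s' t') :
    f * g ∈ crossSpan k (s + s') (t + t') := by
  have : crossSpan k s t * crossSpan k s' t' ≤ crossSpan k (s + s') (t + t') := by
    rw [crossSpan, crossSpan, Submodule.span_mul_span]
    refine Submodule.span_mono ?_
    rintro _ ⟨_, ⟨G, rfl, rfl, rfl⟩, _, ⟨H, rfl, rfl, rfl⟩, rfl⟩
    exact ⟨G + H, by simp, by simp, by simp [bracketProd_add]⟩
  exact this (Submodule.mul_mem_mul hf hg)

/-- The Plücker relation trades an edge inside `P` and an edge inside `Q` for two crossing edges. -/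
theorem bracket_mul_bracket_mem_crossSpan (a b : P) (c d : Q) :
    bracket k (Sum.inl a : P ⊕ Q) (Sum.inl b) * bracket k (Sum.inr c) (Sum.inr d) ∈
      crossSpan k (a ::ₘ b ::ₘ 0) (c ::ₘ d ::ₘ 0) := by
  rw [bracket_plucker]
  refine sub_mem (Submodule.subset_span ⟨(a, c) ::ₘ (b, d) ::ₘ 0, ?_, ?_, ?_⟩)
    (Submodule.subset_span ⟨(a, d) ::ₘ (b, c) ::ₘ 0, ?_, ?_, ?_⟩)
  all_goals simp [bracketProd]
  exact Multiset.pair_comm d c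

theorem bracketProd_mul_bracketProd_mem_crossSpan (A : Multiset (P × P)) (B : Multiset (Q × Q))
    (h : A.card = B.card) :
    bracketProd k (A.map (Prod.map (Sum.inl : P → P ⊕ Q) Sum.inl)) *
      bracketProd k (B.map (Prod.map (Sum.inr : Q → P ⊕ Q) Sum.inr)) ∈
      crossSpan k (endpoints A) (endpoints B) := by
  induction A using Multiset.induction generalizing B with
  | empty =>
    obtain rfl : B = 0 := by simpa [eq_comm] using h
    simpa [bracketProd, endpoints] using
      bracketProd_cross_mem_crossSpan (k := k) (0 : Multiset (P × Q))
  | cons e A ih =>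
    obtain ⟨e', B, rfl⟩ : ∃ e' B', B = e' ::ₘ B' := by
      have : B ≠ 0 := by rintro rfl; simp at h
      obtain ⟨e', he'⟩ := Multiset.exists_mem_of_ne_zero this
      exact ⟨e', Multiset.exists_cons_of_mem he'⟩
    have := mul_mem_crossSpan (bracket_mul_bracket_mem_crossSpan (k := k) e.1 e.2 e'.1 e'.2)
      (ih B (by simpa using h))
    obtain ⟨a, b⟩ := e
    obtain ⟨c, d⟩ := e'
    simp only [Multiset.map_cons, Prod.map_apply, bracketProd_cons, endpoints_cons]
    simp only [Multiset.cons_add, zero_add] at this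
    rwa [mul_mul_mul_comm]

/-- The edges of a multigraph on `P ⊕ Q` are sorted into those inside `P`, those inside `Q` and the
crossing ones; `ε` is the sign that comes from orienting the crossing edges from `P` to `Q`. -/
theorem exists_sort_edges (G : Multiset ((P ⊕ Q) × (P ⊕ Q))) :
    ∃ (A : Multiset (P × P)) (B : Multiset (Q × Q)) (C : Multiset (P × Q)),
      endpoints G = (endpoints A + C.map Prod.fst).map Sum.inl +
        (endpoints B + C.map Prod.snd).map Sum.inr ∧
      ∃ ε : k, bracketProd k G = ε •
        (bracketProd k (A.map (Prod.map (Sum.inl : P → P ⊕ Q) Sum.inl)) *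
          bracketProd k (B.map (Prod.map (Sum.inr : Q → P ⊕ Q) Sum.inr)) *
          bracketProd k (C.map (Prod.map Sum.inl Sum.inr))) := by
  induction G using Multiset.induction with
  | empty => exact ⟨0, 0, 0, by simp [endpoints], 1, by simp [bracketProd]⟩
  | cons e G ih =>
    obtain ⟨A, B, C, hG, ε, hε⟩ := ih
    obtain ⟨a | a, b | b⟩ := e
    · refine ⟨(a, b) ::ₘ A, B, C, ?_, ε, ?_⟩
      · simp [endpoints_cons, hG]
      · simp only [Multiset.map_cons, Prod.map, bracketProd_cons, hε, smul_eq_C_mul]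
        ring
    · refine ⟨A, B, (a, b) ::ₘ C, ?_, ε, ?_⟩
      · simp [endpoints_cons, hG, Multiset.cons_swap]
      · simp only [Multiset.map_cons, Prod.map, bracketProd_cons, hε, smul_eq_C_mul]
        ring
    · refine ⟨A, B, (b, a) ::ₘ C, ?_, -ε, ?_⟩
      · simp [endpoints_cons, hG]
      · simp only [Multiset.map_cons, Prod.map, bracketProd_cons, hε, smul_eq_C_mul,
          bracket_swap (Sum.inr a) (Sum.inl b), map_neg]
        ring
    · refine ⟨A, (a, b) ::ₘ B, C, ?_, ε, ?_⟩
      · simp [endpoints_cons, hG]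
      · simp only [Multiset.map_cons, Prod.map, bracketProd_cons, hε, smul_eq_C_mul]
        ring

theorem map_inl_add_map_inr_inj {s s' : Multiset P} {t t' : Multiset Q}
    (h : s.map Sum.inl + t.map Sum.inr = s'.map Sum.inl + t'.map Sum.inr) : s = s' ∧ t = t' := by
  have hl := congrArg (Multiset.filterMap Sum.getLeft?) h
  have hr := congrArg (Multiset.filterMap Sum.getRight?) h
  have key : ∀ (s : Multiset P) (t : Multiset Q),
      (s.map Sum.inl + t.map Sum.inr).filterMap Sum.getLeft? = s ∧
      (s.map Sum.inl + t.map Sum.inr).filterMap Sum.getRight? = t := by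
    intro s t
    induction s using Quotient.inductionOn
    induction t using Quotient.inductionOn
    constructor <;> simp [List.filterMap_map, Function.comp_def]
  rw [(key s t).1, (key s' t').1] at hl
  rw [(key s t).2, (key s' t').2] at hr
  exact ⟨hl, hr⟩

/-- If both sides have the same total degree, there are as many edges inside `P` as inside `Q`, so
the Plücker relation removes them in pairs. -/
theorem bracketSpan_le_crossSpan (s : Multiset P) (t : Multiset Q) (h : s.card = t.card) :
    bracketSpan k (s.map Sum.inl + t.map Sum.inr) ≤ crossSpan k s t := by
  refine Submodule.span_le.2 ?_
  rintro _ ⟨G, hG, rfl⟩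
  obtain ⟨A, B, C, hABC, ε, hε⟩ := exists_sort_edges (k := k) G
  obtain ⟨rfl, rfl⟩ := map_inl_add_map_inr_inj (hG.symm.trans hABC)
  simp only [Multiset.card_add, card_endpoints, Multiset.card_map] at h
  rw [hε]
  exact Submodule.smul_mem _ _ (mul_mem_crossSpan
    (bracketProd_mul_bracketProd_mem_crossSpan A B (by omega)) (bracketProd_cross_mem_crossSpan C))

/-- A regular bipartite multigraph of positive degree contains a perfect matching, by Hall's
theorem. -/
theorem exists_perfect_matching [Fintype P] [Fintype Q] (d : ℕ) (G : Multiset (P × Q))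
    (hP : G.map Prod.fst = (d + 1) • Finset.univ.val)
    (hQ : G.map Prod.snd = (d + 1) • Finset.univ.val) :
    ∃ M G' : Multiset (P × Q), G = M + G' ∧ M.map Prod.fst = Finset.univ.val ∧
      M.map Prod.snd = Finset.univ.val := by
  classical
  have hcount : ∀ {α : Type} [Fintype α] (S : Finset α) (g : P × Q → α),
      G.map g = (d + 1) • Finset.univ.val →
      (G.filter fun e => g e ∈ S).card = (d + 1) * S.card := by
    intro α _ S g hg
    rw [← Multiset.countP_map g G (· ∈ S), hg, Multiset.countP_nsmul,
      Multiset.countP_eq_card_filter, ← Finset.filter_val, Finset.card_val,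
      Finset.filter_mem_eq_inter, Finset.univ_inter]
  have hcard : Fintype.card P = Fintype.card Q := by
    have h1 := congrArg Multiset.card hP
    have h2 := congrArg Multiset.card hQ
    simp only [Multiset.card_map, Multiset.card_nsmul, Finset.card_val] at h1 h2
    exact Nat.eq_of_mul_eq_mul_left d.succ_pos (h1.symm.trans h2)
  obtain ⟨f, hf, hfG⟩ := (Finset.all_card_le_biUnion_card_iff_exists_injective
    fun p : P => Finset.univ.filter fun q : Q => (p, q) ∈ G).1 <| by
      intro S
      refine Nat.le_of_mul_le_mul_left ?_ d.succ_pos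
      rw [← hcount S Prod.fst hP, ← hcount _ Prod.snd hQ]
      refine Multiset.card_le_card ?_
      rw [Multiset.le_filter]
      refine ⟨Multiset.filter_le _ _, fun e he => ?_⟩
      rw [Multiset.mem_filter] at he
      exact Finset.mem_biUnion.2 ⟨e.1, he.2, by simpa using he.1⟩
  have hbij : Function.Bijective f :=
    (Fintype.bijective_iff_injective_and_card f).2 ⟨hf, hcard⟩
  have hle : (Finset.univ.val.map fun p => (p, f p)) ≤ G := by
    refine (Multiset.le_iff_subset (Finset.univ.nodup.map fun p p' h => congrArg Prod.fst h)).2 ?_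
    intro e he
    obtain ⟨p, -, rfl⟩ := Multiset.mem_map.1 he
    simpa using hfG p
  obtain ⟨G', rfl⟩ := Multiset.le_iff_exists_add.1 hle
  refine ⟨_, G', rfl, by simp, ?_⟩
  rw [Multiset.map_map]
  exact congrArg Finset.val (Finset.map_univ_equiv (Equiv.ofBijective f hbij))

theorem bracketProd_cross_mem_pow [Fintype P] [Fintype Q] (d : ℕ) (G : Multiset (P × Q))
    (hP : G.map Prod.fst = d • Finset.univ.val) (hQ : G.map Prod.snd = d • Finset.univ.val) :
    bracketProd k (G.map (Prod.map Sum.inl Sum.inr)) ∈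
      bracketSpan k ((Finset.univ : Finset P).val.map Sum.inl +
        (Finset.univ : Finset Q).val.map Sum.inr) ^ d := by
  induction d generalizing G with
  | zero =>
    obtain rfl : G = 0 := by simpa using hP
    rw [pow_zero]
    exact Submodule.one_le.1 le_rfl
  | succ d ih =>
    obtain ⟨M, G, rfl, hM1, hM2⟩ := exists_perfect_matching d G hP hQ
    rw [Multiset.map_add, hM1, succ_nsmul', add_right_inj] at hP
    rw [Multiset.map_add, hM2, succ_nsmul', add_right_inj] at hQ
    rw [Multiset.map_add, bracketProd_add, pow_succ']
    refine Submodule.mul_mem_mul (Submodule.subset_span ⟨_, ?_, rfl⟩) (ih G hP hQ)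
    rw [← hM1, ← hM2]
    simp [endpoints, Multiset.map_map]

/-- For `|s|` even, a bracket monomial of multidegree `d • s` is a combination of products of `d`
bracket monomials of multidegree `s`. Replace each point by as many copies as its multiplicity in
`s`, distribute the copies over two halves of equal size, make the graph bipartite and split it into
`d` perfect matchings; then let the copies collide again. -/
theorem bracketSpan_nsmul_le_pow {s : Multiset V} (hs : Even s.card) (d : ℕ) :
    bracketSpan k (d • s) ≤ bracketSpan k s ^ d := by
  obtain ⟨m, hm⟩ := hs
  induction s using Quotient.inductionOn with | _ l
  change l.length = m + m at hm
  let π : Fin (l.take m).length ⊕ Fin (l.drop m).length → V :=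
    Sum.elim (l.take m).get (l.drop m).get
  set p : Multiset (Fin (l.take m).length) := Finset.univ.val with hp
  set q : Multiset (Fin (l.drop m).length) := Finset.univ.val with hq
  have hπ : (⟦l⟧ : Multiset V) = (p.map Sum.inl + q.map Sum.inr).map π := by
    rw [Multiset.map_add, Multiset.map_map, Multiset.map_map]
    change (l : Multiset V) = p.map (l.take m).get + q.map (l.drop m).get
    rw [hp, hq, Fin.univ_val_map, Fin.univ_val_map, List.ofFn_get, List.ofFn_get,
      Multiset.coe_add, List.take_append_drop]
  rw [hπ, ← Multiset.map_nsmul, ← map_movePoints_bracketSpan, ← map_movePoints_bracketSpan,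
    ← Submodule.map_pow]
  refine Submodule.map_mono ?_
  rw [nsmul_add, ← Multiset.map_nsmul, ← Multiset.map_nsmul]
  refine (bracketSpan_le_crossSpan _ _ ?_).trans ?_
  · simp only [hp, hq, Multiset.card_nsmul, Finset.card_val, Finset.card_univ, Fintype.card_fin,
      List.length_take, List.length_drop]
    congr 1
    omega
  · refine Submodule.span_le.2 ?_
    rintro _ ⟨G, h1, h2, rfl⟩
    exact bracketProd_cross_mem_pow d G h1 h2

end Bipartite

/-! ### The graded pieces -/

section Kempe

variable {n : ℕ} {k : Type u} [CommRing k]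

/-- The weight vector `w` as the multiset that contains each `i` with multiplicity `w i`. -/
def weightMultiset (w : Fin n → ℕ) : Multiset (Fin n) :=
  ∑ i, Multiset.replicate (w i) i

theorem count_weightMultiset (w : Fin n → ℕ) (i : Fin n) :
    (weightMultiset w).count i = w i := by
  simp [weightMultiset, Multiset.count_sum', Multiset.count_replicate]

theorem card_weightMultiset (w : Fin n → ℕ) : (weightMultiset w).card = ∑ i, w i := by
  simp [weightMultiset]

theorem weightMultiset_nsmul (d : ℕ) (w : Fin n → ℕ) :
    weightMultiset (d • w) = d • weightMultiset w := by
  ext i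
  simp [count_weightMultiset]

theorem weight_coordDegree_eq_iff (w : Fin n → ℕ) (e : Fin n × Fin 2 →₀ ℕ) :
    Finsupp.weight (coordDegree n) e = w ↔
      Finsupp.weight (ptDegree (Fin n)) e = weightMultiset w := by
  have h : ∀ i, Finsupp.weight (coordDegree n) e i =
      (Finsupp.weight (ptDegree (Fin n)) e).count i := by
    intro i
    induction e using Finsupp.induction_linear with
    | zero => simp
    | add f g hf hg => simp [hf, hg]
    | single q m =>
      simp [Finsupp.weight_single, ptDegree, coordDegree, Pi.single_apply,
        Multiset.count_singleton]
  rw [funext_iff, Multiset.ext]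
  simp only [h, count_weightMultiset]

/-- The graded pieces are spanned by bracket monomials: the first fundamental theorem in the
notation of weights. -/
theorem piece_eq_bracketSpan (w : Fin n → ℕ) (d : ℕ) :
    piece k w d = bracketSpan k (d • weightMultiset w) := by
  have key : ∀ f : CoordRing n k, IsWeightedHomogeneous (coordDegree n) f (d • w) ↔
      IsWeightedHomogeneous (ptDegree (Fin n)) f (d • weightMultiset w) := by
    intro f
    rw [← weightMultiset_nsmul]
    exact forall_congr' fun e => imp_congr_right fun _ => weight_coordDegree_eq_iff _ e
  ext f
  constructor
  · rintro ⟨hf, hinv⟩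
    exact IsInvariant.mem_bracketSpan hinv ((key f).1 hf)
  · intro hf
    exact ⟨(key f).2 (isWeightedHomogeneous_of_mem_bracketSpan hf),
      bracketSpan_le_invariants _ hf⟩

theorem piece_mul_eps_le_pow (w : Fin n → ℕ) (d : ℕ) :
    piece k w (d * eps w) ≤ piece k w (eps w) ^ d := by
  rw [piece_eq_bracketSpan, piece_eq_bracketSpan, mul_nsmul']
  refine bracketSpan_nsmul_le_pow ?_ d
  rw [Multiset.card_nsmul, card_weightMultiset, eps]
  split_ifs with h
  · simpa using h
  · simp

/-- The number of half-edges of a multigraph is even, so there are no invariants of odd total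
degree. -/
theorem piece_eq_bot_of_not_dvd (w : Fin n → ℕ) (d : ℕ) (hd : ¬ eps w ∣ d) :
    piece k w d = ⊥ := by
  rw [piece_eq_bracketSpan]
  refine bracketSpan_eq_bot_of_odd ?_
  rw [eps] at hd
  split_ifs at hd with h
  · simp at hd
  · rw [Multiset.card_nsmul, card_weightMultiset, Nat.odd_mul]
    exact ⟨Nat.not_even_iff_odd.1 fun h' => hd h'.two_dvd, Nat.not_even_iff_odd.1 h⟩

theorem eps_pos (w : Fin n → ℕ) : 0 < eps w := by
  unfold eps; split_ifs <;> simp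

theorem of_mem_adjoin (w : Fin n → ℕ) (d : ℕ) (x : piece k w d) :
    DirectSum.of (fun d : ℕ => piece k w d) d x ∈
      Algebra.adjoin k (Set.range (DirectSum.of (fun d : ℕ => piece k w d) (eps w))) := by
  set S := Algebra.adjoin k (Set.range (DirectSum.of (fun d : ℕ => piece k w d) (eps w)))
  -- `N d` is the part of `piece k w d` whose image in degree `d` lies in the generated subalgebra.
  let N : ℕ → Submodule k (CoordRing n k) := fun d =>
    ((Subalgebra.toSubmodule S).comap (DirectSum.lof k ℕ (fun d : ℕ => piece k w d) d)).map
      (piece k w d).subtype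
  have hN : ∀ m, piece k w (eps w) ^ m ≤ N (m * eps w) := by
    intro m
    induction m with
    | zero =>
      rw [pow_zero, Submodule.one_le, zero_mul]
      exact ⟨1, S.one_mem, rfl⟩
    | succ m ih =>
      rw [pow_succ, add_mul, one_mul]
      refine (mul_le_mul_left ih _).trans (Submodule.mul_le.2 ?_)
      rintro _ ⟨y, hy, rfl⟩ z hz
      refine ⟨⟨_, SetLike.mul_mem_graded y.2 hz⟩, ?_, rfl⟩
      have := S.mul_mem hy
        (Algebra.subset_adjoin (Set.mem_range_self (⟨z, hz⟩ : piece k w (eps w))))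
      rwa [DirectSum.lof_eq_of, DirectSum.of_mul_of] at this
  by_cases hd : eps w ∣ d
  · obtain ⟨m, rfl⟩ := exists_eq_mul_left_of_dvd hd
    obtain ⟨y, hy, hyx⟩ := hN m (piece_mul_eps_le_pow w m x.2)
    rwa [← Subtype.ext hyx]
  · have hx : x = 0 :=
      Subtype.ext ((Submodule.eq_bot_iff _).1 (piece_eq_bot_of_not_dvd w d hd) x.1 x.2)
    rw [hx, map_zero]
    exact zero_mem _

end Kempe
end PointsOnLine

theorem mainTheorem3 {k : Type u} [CommRing k] {n : ℕ} (w : Fin n → ℕ) :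
    ((∃ d : ℕ, 0 < d ∧ PointsOnLine.piece k w d ≠ ⊥) →
      IsLeast {d : ℕ | 0 < d ∧ PointsOnLine.piece k w d ≠ ⊥} (PointsOnLine.eps w)) ∧
    Algebra.adjoin k
      (Set.range (DirectSum.of (fun d : ℕ => PointsOnLine.piece k w d) (PointsOnLine.eps w))) =
      (⊤ : Subalgebra k (PointsOnLine.InvariantRing k w)) := by
  have hdvd : ∀ d, PointsOnLine.piece k w d ≠ ⊥ → PointsOnLine.eps w ∣ d := fun d hd =>
    not_not.1 fun h => hd (PointsOnLine.piece_eq_bot_of_not_dvd w d h)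
  constructor
  · rintro ⟨d, hd0, hd⟩
    refine ⟨⟨PointsOnLine.eps_pos w, fun hbot => hd ?_⟩,
      fun e he => Nat.le_of_dvd he.1 (hdvd e he.2)⟩
    obtain ⟨m, rfl⟩ := hdvd d hd
    have hm : m ≠ 0 := by rintro rfl; simp at hd0
    rw [mul_comm, eq_bot_iff]
    refine (PointsOnLine.piece_mul_eps_le_pow w m).trans ?_
    rw [hbot, ← Submodule.zero_eq_bot, zero_pow hm]
  · refine eq_top_iff.2 fun x _ => ?_
    induction x using DirectSum.induction_on with
    | zero => exact zero_mem _
    | of d x => exact PointsOnLine.of_mem_adjoin w d x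
    | add x y hx hy => exact add_mem (hx trivial) (hy trivial)
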